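/- Let $(M,g)$ be a smooth Lorentzian manifold of finite dimension with signature $(-,+,\dots,+)$, let $\nabla$ be its Levi-Civita connection, and let $\xi$ be a smooth vector field on $M$ that is timelike, $g(\xi,\xi)<0$ everywhere. Indices are lowered with $g$. Functions and one-forms are smooth. Terminology. $\xi$ is \emph{conformal Killing with factor} $\kappa:M\to\mathbb R$ if $\nabla_i\xi_j+\nabla_j\xi_i=2\kappa g_{ij}$, i.e. $\nabla_i\xi_j=\kappa g_{ij}+F_{ij}$ with $F_{ij}=\tfrac12(\nabla_i\xi_j-\nabla_j\xi_i)$; it is \emph{Killing} if $\nabla_i\xi_j+\nabla_j\xi_i=0$. It is \emph{hypersurface orthogonal} if every point has an open neighbourhood $U$ with smooth functions $f,\lambda$ on $U$ such that $df\neq 0$ everywhere on $U$ and $\xi_i=\lambda\,\partial_i f$ on $U$. It is \emph{doubly torqued} with data $(\kappa,\alpha,\beta)$, where $\alpha,\beta$ are one-forms, if $$\nabla_i\xi_j=\kappa g_{ij}+\alpha_i\xi_j+\xi_i\beta_j,\qquad \alpha_k\xi^k=0,\quad \beta_k\xi^k=0 .$$ Then: 1. If $\xi$ is conformal Killing with factor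 $\kappa$, then $\xi$ is hypersurface orthogonal if and only if there is a one-form $\alpha$ with $\alpha_k\xi^k=0$ and $F_{ij}=\alpha_i\xi_j-\xi_i\alpha_j$; equivalently, if and only if there is a one-form $\alpha$ with $\alpha_k\xi^k=0$ and $$\nabla_i\xi_j=\kappa g_{ij}+\alpha_i\xi_j-\xi_i\alpha_j .$$ 2. For every function $\kappa$: $\xi$ is doubly torqued with data $(\kappa,\alpha,\beta)$ for some one-forms with $\alpha=-\beta$ if and only if $\xi$ is conformal Killing with factor $\kappa$ and hypersurface orthogonal. 3. $\xi$ is doubly torqued with data $(0,\alpha,\beta)$ for some one-forms with $\alpha=-\beta$ if and only if $\xi$ is Killing and hypersurface orthogonal. -/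

import Mathlib

open scoped Manifold ContDiff Topology Bundle

noncomputable section

/-- A smooth Lorentzian metric of signature `(-,+,…,+)` on the manifold `M`: a smooth field of
symmetric bilinear forms on the tangent spaces, each of which is negative on some vector `u` and
positive definite on the orthogonal complement of `u`. -/
structure LorentzMetric (E : Type*) [NormedAddCommGroup E] [NormedSpace ℝ E]
    (M : Type*) [TopologicalSpace M] [ChartedSpace E M] [IsManifold 𝓘(ℝ, E) ∞ M] where
  val (x : M) : TangentSpace 𝓘(ℝ, E) x →L[ℝ] TangentSpace 𝓘(ℝ, E) x →L[ℝ] ℝ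
  symm (x : M) (v w : TangentSpace 𝓘(ℝ, E) x) : val x v w = val x w v
  lorentzian (x : M) : ∃ u : TangentSpace 𝓘(ℝ, E) x, val x u u < 0 ∧
    ∀ v : TangentSpace 𝓘(ℝ, E) x, val x u v = 0 → v ≠ 0 → 0 < val x v v
  contMDiff : ContMDiff 𝓘(ℝ, E) (𝓘(ℝ, E).prod 𝓘(ℝ, E →L[ℝ] E →L[ℝ] ℝ)) ∞
    (fun x ↦ Bundle.TotalSpace.mk' (E →L[ℝ] E →L[ℝ] ℝ) x (val x))

variable {E : Type*} [NormedAddCommGroup E] [NormedSpace ℝ E]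
  {M : Type*} [TopologicalSpace M] [ChartedSpace E M] [IsManifold 𝓘(ℝ, E) ∞ M]

/-- A smooth vector field. -/
def IsSmoothVectorField (ξ : Π x : M, TangentSpace 𝓘(ℝ, E) x) : Prop :=
  ContMDiff 𝓘(ℝ, E) 𝓘(ℝ, E).tangent ∞ (fun x ↦ (⟨x, ξ x⟩ : TangentBundle 𝓘(ℝ, E) M))

/-- A smooth one-form. -/
def IsSmoothOneForm (α : Π x : M, TangentSpace 𝓘(ℝ, E) x →L[ℝ] ℝ) : Prop :=
  ContMDiff 𝓘(ℝ, E) (𝓘(ℝ, E).prod 𝓘(ℝ, E →L[ℝ] ℝ)) ∞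
    (fun x ↦ Bundle.TotalSpace.mk' (E →L[ℝ] ℝ) x (α x))

namespace LorentzMetric

variable (g : LorentzMetric E M)

/-- `ξ` is timelike everywhere. -/
def IsTimelike (ξ : Π x : M, TangentSpace 𝓘(ℝ, E) x) : Prop :=
  ∀ x : M, g.val x (ξ x) (ξ x) < 0

/-- `ξ` is hypersurface orthogonal: near every point it is orthogonal to the level hypersurfaces
of a smooth function `f` without critical points, `ξ_i = lam ∂_i f`. -/
def IsHypersurfaceOrthogonal (ξ : Π x : M, TangentSpace 𝓘(ℝ, E) x) : Prop :=
  ∀ p : M, ∃ U : Set M, IsOpen U ∧ p ∈ U ∧ ∃ f lam : M → ℝ,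
    ContMDiffOn 𝓘(ℝ, E) 𝓘(ℝ, ℝ) ∞ f U ∧ ContMDiffOn 𝓘(ℝ, E) 𝓘(ℝ, ℝ) ∞ lam U ∧
    (∀ x ∈ U, mvfderiv 𝓘(ℝ, E) f x ≠ 0) ∧
    ∀ x ∈ U, ∀ v : TangentSpace 𝓘(ℝ, E) x,
      g.val x (ξ x) v = lam x * mvfderiv 𝓘(ℝ, E) f x v

theorem mdifferentiableAt_val {X Y : Π x : M, TangentSpace 𝓘(ℝ, E) x} {x : M}
    (hX : MDiffAt (T% X) x) (hY : MDiffAt (T% Y) x) :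
    MDiffAt (fun y ↦ g.val y (X y) (Y y)) x := by
  have : MDifferentiableAt 𝓘(ℝ, E) (𝓘(ℝ, E).prod 𝓘(ℝ))
      (fun m ↦ Bundle.TotalSpace.mk' ℝ (E := Bundle.Trivial M ℝ) m (g.val m (X m) (Y m))) x := by
    apply MDifferentiableAt.clm_bundle_apply₂ (F₁ := E) (F₂ := E)
    · exact (g.contMDiff x).mdifferentiableAt (by simp)
    · exact hX
    · exact hY
  simp only [mdifferentiableAt_totalSpace] at this
  exact this.2

/-- The Koszul expression
`½ (X g(Y,Z) + Y g(X,Z) - Z g(X,Y) + g([X,Y],Z) - g([X,Z],Y) - g([Y,Z],X))` at the point `x`. -/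
def koszul (X Y Z : Π x : M, TangentSpace 𝓘(ℝ, E) x) (x : M) : ℝ :=
  (1 / 2 : ℝ) * (mvfderiv 𝓘(ℝ, E) (fun y ↦ g.val y (Y y) (Z y)) x (X x)
    + mvfderiv 𝓘(ℝ, E) (fun y ↦ g.val y (X y) (Z y)) x (Y x)
    - mvfderiv 𝓘(ℝ, E) (fun y ↦ g.val y (X y) (Y y)) x (Z x)
    + g.val x (VectorField.mlieBracket 𝓘(ℝ, E) X Y x) (Z x)
    - g.val x (VectorField.mlieBracket 𝓘(ℝ, E) X Z x) (Y x)
    - g.val x (VectorField.mlieBracket 𝓘(ℝ, E) Y Z x) (X x))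

theorem nondegenerate (x : M) (v : TangentSpace 𝓘(ℝ, E) x)
    (h : ∀ w, g.val x v w = 0) : v = 0 := by
  obtain ⟨u, -, hu⟩ := g.lorentzian x
  by_contra hv
  have := hu v (by rw [g.symm, h]) hv
  rw [h] at this
  exact lt_irrefl _ this

theorem val_injective (x : M) : Function.Injective (g.val x).toLinearMap := by
  rw [← LinearMap.ker_eq_bot, LinearMap.ker_eq_bot']
  intro v hv
  exact g.nondegenerate x v fun w ↦ congrArg (fun φ : TangentSpace 𝓘(ℝ, E) x →L[ℝ] ℝ ↦ φ w) hv

theorem ext_val {x : M} {v w : TangentSpace 𝓘(ℝ, E) x} (h : ∀ u, g.val x v u = g.val x w u) :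
    v = w :=
  g.val_injective x (ContinuousLinearMap.ext h)

variable [FiniteDimensional ℝ E]

instance finiteDimensional_tangentSpace (x : M) :
    FiniteDimensional ℝ (TangentSpace 𝓘(ℝ, E) x) :=
  inferInstanceAs (FiniteDimensional ℝ E)

/-- Lowering an index: the linear isomorphism `v ↦ g(v, ·)`. -/
def flat (x : M) : TangentSpace 𝓘(ℝ, E) x ≃ₗ[ℝ] (TangentSpace 𝓘(ℝ, E) x →L[ℝ] ℝ) :=
  LinearEquiv.ofBijective (g.val x).toLinearMap ⟨g.val_injective x, by
    have : T2Space (TangentSpace 𝓘(ℝ, E) x) := inferInstanceAs (T2Space E)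
    have e : (TangentSpace 𝓘(ℝ, E) x →L[ℝ] ℝ) ≃ₗ[ℝ] Module.Dual ℝ (TangentSpace 𝓘(ℝ, E) x) :=
      LinearMap.toContinuousLinearMap.symm
    have := Module.Finite.equiv e.symm
    refine (LinearMap.injective_iff_surjective_of_finrank_eq_finrank ?_).1 (g.val_injective x)
    rw [e.finrank_eq, Subspace.dual_finrank_eq]⟩

/-- Raising an index: the inverse of `v ↦ g(v, ·)`. -/
def sharp (x : M) : (TangentSpace 𝓘(ℝ, E) x →L[ℝ] ℝ) →L[ℝ] TangentSpace 𝓘(ℝ, E) x :=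
  have := Module.Finite.equiv (g.flat x)
  LinearMap.toContinuousLinearMap (g.flat x).symm.toLinearMap

theorem val_sharp (x : M) (φ : TangentSpace 𝓘(ℝ, E) x →L[ℝ] ℝ) (v : TangentSpace 𝓘(ℝ, E) x) :
    g.val x (g.sharp x φ) v = φ v :=
  congrArg (fun ψ : TangentSpace 𝓘(ℝ, E) x →L[ℝ] ℝ ↦ ψ v) ((g.flat x).apply_symm_apply φ)

variable {g} in
theorem tensorialAt_koszul_left {Y Z : Π x : M, TangentSpace 𝓘(ℝ, E) x} {x : M}
    (hY : MDiffAt (T% Y) x) (hZ : MDiffAt (T% Z) x) :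
    TensorialAt 𝓘(ℝ, E) E (fun X ↦ g.koszul X Y Z x) x where
  smul {f X} hf hX := by
    have h1 := mvfderiv_fun_mul hf (g.mdifferentiableAt_val hX hZ)
    have h2 := mvfderiv_fun_mul hf (g.mdifferentiableAt_val hX hY)
    simp [koszul, h1, h2, VectorField.mlieBracket_smul_left hf hX]
    ring
  add {X X'} hX hX' := by
    have h1 := mvfderiv_fun_add (g.mdifferentiableAt_val hX hZ) (g.mdifferentiableAt_val hX' hZ)
    have h2 := mvfderiv_fun_add (g.mdifferentiableAt_val hX hY) (g.mdifferentiableAt_val hX' hY)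
    simp [koszul, h1, h2, VectorField.mlieBracket_add_left hX hX']
    ring

variable {g} in
theorem tensorialAt_koszul_right {X Y : Π x : M, TangentSpace 𝓘(ℝ, E) x} {x : M}
    (hX : MDiffAt (T% X) x) (hY : MDiffAt (T% Y) x) :
    TensorialAt 𝓘(ℝ, E) E (fun Z ↦ g.koszul X Y Z x) x where
  smul {f Z} hf hZ := by
    have h1 := mvfderiv_fun_mul hf (g.mdifferentiableAt_val hX hZ)
    have h2 := mvfderiv_fun_mul hf (g.mdifferentiableAt_val hY hZ)
    simp [koszul, h1, h2, VectorField.mlieBracket_smul_right hf hZ, g.symm x (Z x)]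
    ring
  add {Z Z'} hZ hZ' := by
    have h1 := mvfderiv_fun_add (g.mdifferentiableAt_val hX hZ) (g.mdifferentiableAt_val hX hZ')
    have h2 := mvfderiv_fun_add (g.mdifferentiableAt_val hY hZ) (g.mdifferentiableAt_val hY hZ')
    simp [koszul, h1, h2, VectorField.mlieBracket_add_right hZ hZ']
    ring

theorem koszul_add {X Y Y' Z : Π x : M, TangentSpace 𝓘(ℝ, E) x} {x : M}
    (hX : MDiffAt (T% X) x) (hY : MDiffAt (T% Y) x) (hY' : MDiffAt (T% Y') x)
    (hZ : MDiffAt (T% Z) x) :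
    g.koszul X (Y + Y') Z x = g.koszul X Y Z x + g.koszul X Y' Z x := by
  have h1 := mvfderiv_fun_add (g.mdifferentiableAt_val hY hZ) (g.mdifferentiableAt_val hY' hZ)
  have h2 := mvfderiv_fun_add (g.mdifferentiableAt_val hX hY) (g.mdifferentiableAt_val hX hY')
  simp [koszul, h1, h2, VectorField.mlieBracket_add_left hY hY',
    VectorField.mlieBracket_add_right hY hY']
  ring

theorem koszul_smul {X Y Z : Π x : M, TangentSpace 𝓘(ℝ, E) x} {f : M → ℝ} {x : M}
    (hX : MDiffAt (T% X) x) (hY : MDiffAt (T% Y) x) (hZ : MDiffAt (T% Z) x) (hf : MDiffAt f x) :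
    g.koszul X (f • Y) Z x = f x * g.koszul X Y Z x
      + mvfderiv 𝓘(ℝ, E) f x (X x) * g.val x (Y x) (Z x) := by
  have h1 := mvfderiv_fun_mul hf (g.mdifferentiableAt_val hY hZ)
  have h2 := mvfderiv_fun_mul hf (g.mdifferentiableAt_val hX hY)
  simp [koszul, h1, h2, VectorField.mlieBracket_smul_left hf hY,
    VectorField.mlieBracket_smul_right hf hY, g.symm x (Y x) (X x)]
  ring

open Classical in
/-- The bilinear form `(X, Z) ↦ g(∇_X Y, Z)` at the point `x`, given by the Koszul formula.
(It is `0` if `Y` is not differentiable at `x`.) -/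
def lowerNabla (Y : Π x : M, TangentSpace 𝓘(ℝ, E) x) (x : M) :
    TangentSpace 𝓘(ℝ, E) x →L[ℝ] TangentSpace 𝓘(ℝ, E) x →L[ℝ] ℝ :=
  if hY : MDiffAt (T% Y) x then
    TensorialAt.mkHom₂ (fun X Z ↦ g.koszul X Y Z x) x
      (fun _ hZ ↦ tensorialAt_koszul_left hY hZ) (fun _ hX ↦ tensorialAt_koszul_right hX hY)
  else 0

theorem lowerNabla_apply {X Y Z : Π x : M, TangentSpace 𝓘(ℝ, E) x} {x : M}
    (hX : MDiffAt (T% X) x) (hY : MDiffAt (T% Y) x) (hZ : MDiffAt (T% Z) x) :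
    g.lowerNabla Y x (X x) (Z x) = g.koszul X Y Z x := by
  rw [lowerNabla, dif_pos hY]
  exact TensorialAt.mkHom₂_apply _ _ hX hZ

theorem lowerNabla_eq_extend {Y : Π x : M, TangentSpace 𝓘(ℝ, E) x} {x : M}
    (hY : MDiffAt (T% Y) x) (u v : TangentSpace 𝓘(ℝ, E) x) :
    g.lowerNabla Y x u v = g.koszul (FiberBundle.extend E u) Y (FiberBundle.extend E v) x := by
  rw [lowerNabla, dif_pos hY]
  rfl

/-- The Levi-Civita connection of the metric; `g.leviCivita Y x u` is `∇_u Y` at `x`.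
`leviCivita_torsion` and `leviCivita_metric` below show that it is torsion-free and metric. -/
def leviCivita : CovariantDerivative 𝓘(ℝ, E) E (TangentSpace 𝓘(ℝ, E) : M → Type _) where
  toFun Y x := (g.sharp x).comp (g.lowerNabla Y x)
  isCovariantDerivativeOnUniv :=
    { add := by
        intro Y Y' x hY hY' _
        ext u
        refine g.ext_val fun v ↦ ?_
        have hs : MDiffAt (T% (Y + Y')) x := mdifferentiableAt_add_section hY hY'
        have := g.koszul_add (FiberBundle.mdifferentiableAt_extend 𝓘(ℝ, E) E u) hY hY'
          (FiberBundle.mdifferentiableAt_extend 𝓘(ℝ, E) E v)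
        rw [← g.lowerNabla_eq_extend hs, ← g.lowerNabla_eq_extend hY,
          ← g.lowerNabla_eq_extend hY'] at this
        simpa [val_sharp] using this
      leibniz := by
        intro Y f x hY hf _
        ext u
        refine g.ext_val fun v ↦ ?_
        have hs : MDiffAt (T% (f • Y)) x := hf.smul_section hY
        have := g.koszul_smul (FiberBundle.mdifferentiableAt_extend 𝓘(ℝ, E) E u) hY
          (FiberBundle.mdifferentiableAt_extend 𝓘(ℝ, E) E v) hf
        rw [← g.lowerNabla_eq_extend hs, ← g.lowerNabla_eq_extend hY] at this
        simpa [val_sharp] using this }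

theorem leviCivita_torsion {X Y : Π x : M, TangentSpace 𝓘(ℝ, E) x} {x : M}
    (hX : MDiffAt (T% X) x) (hY : MDiffAt (T% Y) x) :
    g.leviCivita Y x (X x) - g.leviCivita X x (Y x) = VectorField.mlieBracket 𝓘(ℝ, E) X Y x := by
  refine g.ext_val fun v ↦ ?_
  have hv := FiberBundle.mdifferentiableAt_extend 𝓘(ℝ, E) E v
  have h1 := g.lowerNabla_apply hX hY hv
  have h2 := g.lowerNabla_apply hY hX hv
  simp only [FiberBundle.extend_apply_self] at h1 h2
  change g.val x (g.sharp x (g.lowerNabla Y x (X x)) - g.sharp x (g.lowerNabla X x (Y x))) v = _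
  rw [map_sub, sub_apply, val_sharp, val_sharp, h1, h2]
  have hs : (fun y ↦ g.val y (X y) (Y y)) = fun y ↦ g.val y (Y y) (X y) := by
    ext y; exact g.symm _ _ _
  simp [koszul, hs, VectorField.mlieBracket_swap_apply (V := Y) (W := X)]
  ring

theorem leviCivita_metric {X Y Z : Π x : M, TangentSpace 𝓘(ℝ, E) x} {x : M}
    (hX : MDiffAt (T% X) x) (hY : MDiffAt (T% Y) x) (hZ : MDiffAt (T% Z) x) :
    mvfderiv 𝓘(ℝ, E) (fun y ↦ g.val y (Y y) (Z y)) x (X x) =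
      g.val x (g.leviCivita Y x (X x)) (Z x) + g.val x (Y x) (g.leviCivita Z x (X x)) := by
  change _ = g.val x (g.sharp x (g.lowerNabla Y x (X x))) (Z x)
    + g.val x (Y x) (g.sharp x (g.lowerNabla Z x (X x)))
  rw [g.symm x (Y x), val_sharp, val_sharp, g.lowerNabla_apply hX hY hZ,
    g.lowerNabla_apply hX hZ hY]
  have hs : (fun y ↦ g.val y (Z y) (Y y)) = fun y ↦ g.val y (Y y) (Z y) := by
    ext y; exact g.symm _ _ _
  simp [koszul, hs, VectorField.mlieBracket_swap_apply (V := Z) (W := Y)]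
  ring

/-- The covariant derivative `∇_i ξ_j` of the vector field `ξ` with its index lowered, as a
bilinear form: `u^i v^j ∇_i ξ_j = g(∇_u ξ, v)`. -/
def nabla (ξ : Π x : M, TangentSpace 𝓘(ℝ, E) x) (x : M) (u v : TangentSpace 𝓘(ℝ, E) x) : ℝ :=
  g.val x (g.leviCivita ξ x u) v

/-- The antisymmetric part `F_ij = ½ (∇_i ξ_j - ∇_j ξ_i)` of `∇_i ξ_j`. -/
def skewNabla (ξ : Π x : M, TangentSpace 𝓘(ℝ, E) x) (x : M) (u v : TangentSpace 𝓘(ℝ, E) x) : ℝ :=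
  (g.nabla ξ x u v - g.nabla ξ x v u) / 2

/-- `ξ` is conformal Killing with factor `κ`: `∇_i ξ_j + ∇_j ξ_i = 2 κ g_ij`. -/
def IsConformalKilling (ξ : Π x : M, TangentSpace 𝓘(ℝ, E) x) (κ : M → ℝ) : Prop :=
  ∀ (x : M) (u v : TangentSpace 𝓘(ℝ, E) x),
    g.nabla ξ x u v + g.nabla ξ x v u = 2 * κ x * g.val x u v

/-- `ξ` is a Killing vector field: `∇_i ξ_j + ∇_j ξ_i = 0`. -/
def IsKilling (ξ : Π x : M, TangentSpace 𝓘(ℝ, E) x) : Prop :=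
  ∀ (x : M) (u v : TangentSpace 𝓘(ℝ, E) x), g.nabla ξ x u v + g.nabla ξ x v u = 0

/-- `τ` is doubly torqued with data `(κ, α, β)`:
`∇_i τ_j = κ g_ij + α_i τ_j + τ_i β_j` with `α_k τ^k = 0` and `β_k τ^k = 0`. -/
structure IsDoublyTorqued (τ : Π x : M, TangentSpace 𝓘(ℝ, E) x) (κ : M → ℝ)
    (α β : Π x : M, TangentSpace 𝓘(ℝ, E) x →L[ℝ] ℝ) : Prop where
  nabla_eq (x : M) (u v : TangentSpace 𝓘(ℝ, E) x) :
    g.nabla τ x u v = κ x * g.val x u v + α x u * g.val x (τ x) v + g.val x (τ x) u * β x v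
  left_orthogonal (x : M) : α x (τ x) = 0
  right_orthogonal (x : M) : β x (τ x) = 0

end LorentzMetric

end

/-! Write `ξ♭` for `g(ξ, ·)` and `N = g(ξ, ξ)`, which is nowhere zero. Since the Levi-Civita
connection is torsion-free and metric, `dξ♭ = 2F` (`fderiv_chartForm_sub`, in a chart).

If `ξ♭ = λ df` locally, then `2F = dλ ∧ df` (`two_mul_skewNabla_of_eq_mul_mvfderiv`), so `F ∧ ξ♭ =
0`. Contracting with `ξ` and dividing by `N` gives `F = α ⊗ ξ♭ - ξ♭ ⊗ α` with `α = F(·, ξ) / N`, a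
globally defined form that kills `ξ` because `F` is skew.

Conversely, `∇ξ♭ = κ g + α ⊗ ξ♭ - ξ♭ ⊗ α` with `α(ξ) = 0` gives `dN = 2 (κ ξ♭ + N α)`. In `d(ξ♭ /
N)` the `κ` term drops out as a multiple of `ξ♭ ∧ ξ♭` and the `α` terms cancel. Hence `ξ♭ / N` is
closed, and the Poincaré lemma (`exists_potential`) gives `ξ♭ = N df`.

The doubly torqued condition with `β = -α` is this same equation, whose symmetric part is the
conformal Killing equation; the Killing case is `κ = 0`. -/

open scoped Manifold ContDiff Topology Bundle

noncomputable section

/-! ### Coordinate fields and differentials in a chart -/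

variable {E : Type*} [NormedAddCommGroup E] [NormedSpace ℝ E]
  {M : Type*} [TopologicalSpace M] [ChartedSpace E M]

/-- The `a`-th coordinate vector field of the preferred chart at `p`. -/
def coordField (p : M) (a : E) (x : M) : TangentSpace 𝓘(ℝ, E) x :=
  VectorField.mpullback 𝓘(ℝ, E) 𝓘(ℝ, E) (extChartAt 𝓘(ℝ, E) p) (fun _ ↦ a) x

/-- The derivative at `x` of the preferred chart at `p`. -/
def chartDeriv (p x : M) : TangentSpace 𝓘(ℝ, E) x →L[ℝ] E :=
  mfderiv 𝓘(ℝ, E) 𝓘(ℝ, E) (extChartAt 𝓘(ℝ, E) p) x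

/-- The one-form `η` read in the preferred chart at `p`. -/
def chartForm (η : Π x : M, TangentSpace 𝓘(ℝ, E) x →L[ℝ] ℝ) (p : M) (e : E) : E →L[ℝ] ℝ :=
  (η ((extChartAt 𝓘(ℝ, E) p).symm e)).comp
    (mfderiv 𝓘(ℝ, E) 𝓘(ℝ, E) (extChartAt 𝓘(ℝ, E) p) ((extChartAt 𝓘(ℝ, E) p).symm e)).inverse

theorem chartForm_apply (η : Π x : M, TangentSpace 𝓘(ℝ, E) x →L[ℝ] ℝ) (p : M) (e a : E) :
    chartForm η p e a = η ((extChartAt 𝓘(ℝ, E) p).symm e)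
      (coordField p a ((extChartAt 𝓘(ℝ, E) p).symm e)) :=
  rfl

theorem Filter.EventuallyEq.mvfderiv_eq {h h' : M → ℝ} {x : M} (hh : h =ᶠ[𝓝 x] h') :
    mvfderiv 𝓘(ℝ, E) h x = mvfderiv 𝓘(ℝ, E) h' x := by
  ext v
  exact congrArg (fun L : E →L[ℝ] ℝ ↦ L v) hh.mfderiv_eq

theorem mlieBracket_const (a b e : E) :
    VectorField.mlieBracket 𝓘(ℝ, E) (fun _ : E ↦ a) (fun _ : E ↦ b) e = (0 : E) := by
  have h (V W : Π x : E, TangentSpace 𝓘(ℝ, E) x) : VectorField.mlieBracket 𝓘(ℝ, E) V W =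
      VectorField.lieBracketWithin ℝ V W Set.univ := by
    rw [← VectorField.mlieBracketWithin_univ, VectorField.mlieBracketWithin_eq_lieBracketWithin]
  have h0 : VectorField.lieBracketWithin ℝ (fun _ : E ↦ a) (fun _ ↦ b) Set.univ e = 0 := by
    simp [VectorField.lieBracketWithin]
  exact (congrFun (h _ _) e).trans h0

variable [IsManifold 𝓘(ℝ, E) ∞ M]

theorem chartDeriv_coordField {p x : M} (hx : x ∈ (extChartAt 𝓘(ℝ, E) p).source) (a : E) :
    chartDeriv p x (coordField p a x) = a := by
  have : IsManifold 𝓘(ℝ, E) 1 M := .of_le (n := ∞) (by simp)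
  exact (isInvertible_mfderiv_extChartAt hx).self_apply_inverse a

theorem coordField_chartDeriv {p x : M} (hx : x ∈ (extChartAt 𝓘(ℝ, E) p).source)
    (v : TangentSpace 𝓘(ℝ, E) x) :
    coordField p (chartDeriv p x v) x = v := by
  have : IsManifold 𝓘(ℝ, E) 1 M := .of_le (n := ∞) (by simp)
  exact (isInvertible_mfderiv_extChartAt hx).inverse_apply_self v

theorem mvfderiv_comp_extChartAt {p x : M} (hx : x ∈ (extChartAt 𝓘(ℝ, E) p).source)
    {F : E → ℝ} (hF : DifferentiableAt ℝ F (extChartAt 𝓘(ℝ, E) p x))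
    (v : TangentSpace 𝓘(ℝ, E) x) :
    mvfderiv 𝓘(ℝ, E) (F ∘ extChartAt 𝓘(ℝ, E) p) x v = fderiv ℝ F (extChartAt 𝓘(ℝ, E) p x)
      (chartDeriv p x v) := by
  have : IsManifold 𝓘(ℝ, E) 1 M := .of_le (n := ∞) (by simp)
  rw [mvfderiv_comp_apply x hF.mdifferentiableAt (mdifferentiableAt_extChartAt (by simpa using hx))]
  simp only [mvfderiv, mfderiv_eq_fderiv]
  rfl

theorem contMDiffAt_extChartAt_symm {p x : M} (hx : x ∈ (extChartAt 𝓘(ℝ, E) p).source) :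
    ContMDiffAt 𝓘(ℝ, E) 𝓘(ℝ, E) ∞ (extChartAt 𝓘(ℝ, E) p).symm (extChartAt 𝓘(ℝ, E) p x) :=
  (contMDiffOn_extChartAt_symm p).contMDiffAt
    ((isOpen_extChartAt_target p).mem_nhds ((extChartAt 𝓘(ℝ, E) p).map_source hx))

theorem ContMDiffAt.contDiffAt_comp_extChartAt_symm {p x : M}
    (hx : x ∈ (extChartAt 𝓘(ℝ, E) p).source) {h : M → ℝ} (hh : ContMDiffAt 𝓘(ℝ, E) 𝓘(ℝ) ∞ h x) :
    ContDiffAt ℝ ∞ (h ∘ (extChartAt 𝓘(ℝ, E) p).symm) (extChartAt 𝓘(ℝ, E) p x) := by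
  refine ContMDiffAt.contDiffAt (ContMDiffAt.comp _ ?_ (contMDiffAt_extChartAt_symm hx))
  rwa [(extChartAt 𝓘(ℝ, E) p).left_inv hx]

theorem mvfderiv_eq_fderiv_extChartAt {p x : M} (hx : x ∈ (extChartAt 𝓘(ℝ, E) p).source)
    {h : M → ℝ} (hh : ContMDiffAt 𝓘(ℝ, E) 𝓘(ℝ) ∞ h x) (v : TangentSpace 𝓘(ℝ, E) x) :
    mvfderiv 𝓘(ℝ, E) h x v = fderiv ℝ (h ∘ (extChartAt 𝓘(ℝ, E) p).symm)
      (extChartAt 𝓘(ℝ, E) p x)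
      (chartDeriv p x v) := by
  rw [← mvfderiv_comp_extChartAt hx
    ((hh.contDiffAt_comp_extChartAt_symm hx).differentiableAt (by simp))]
  have : h =ᶠ[𝓝 x] (h ∘ (extChartAt 𝓘(ℝ, E) p).symm) ∘ extChartAt 𝓘(ℝ, E) p := by
    filter_upwards [extChartAt_source_mem_nhds' hx] with y hy
    rw [Function.comp_apply, Function.comp_apply, (extChartAt 𝓘(ℝ, E) p).left_inv hy]
  rw [this.mvfderiv_eq]

theorem contMDiffAt_coordField [CompleteSpace E] {p x : M}
    (hx : x ∈ (extChartAt 𝓘(ℝ, E) p).source) (a : E) :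
    ContMDiffAt 𝓘(ℝ, E) 𝓘(ℝ, E).tangent ∞
      (fun y ↦ (⟨y, coordField p a y⟩ : TangentBundle 𝓘(ℝ, E) M)) x := by
  have : IsManifold 𝓘(ℝ, E) 1 M := .of_le (n := ∞) (by simp)
  refine ContMDiffAt.mpullback_vectorField_preimage (n := ∞) (m := ∞)
    (contMDiffAt_vectorSpace_iff_contDiffAt.2 contDiffAt_const)
    (contMDiffAt_extChartAt' (by simpa using hx)) (isInvertible_mfderiv_extChartAt hx) (by simp)

/-- Pullback by the chart commutes with the bracket, and constant fields on `E` commute. -/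
theorem mlieBracket_coordField [CompleteSpace E] {p x : M}
    (hx : x ∈ (extChartAt 𝓘(ℝ, E) p).source) (a b : E) :
    VectorField.mlieBracket 𝓘(ℝ, E) (coordField p a) (coordField p b) x = 0 := by
  have : IsManifold 𝓘(ℝ, E) (minSmoothness ℝ 2) M := .of_le (n := ∞) (by simp [ENat.LEInfty.out])
  have h (c : E) : MDifferentiableAt 𝓘(ℝ, E) 𝓘(ℝ, E).tangent
      (fun y : E ↦ (⟨y, c⟩ : TangentBundle 𝓘(ℝ, E) E)) (extChartAt 𝓘(ℝ, E) p x) :=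
    (contMDiffAt_vectorSpace_iff_contDiffAt.2
      (contDiffAt_const (n := ∞))).mdifferentiableAt (by simp)
  have := VectorField.mpullback_mlieBracket (n := ∞) (h a) (h b)
    (contMDiffAt_extChartAt' (I := 𝓘(ℝ, E)) (n := ∞) (by simpa using hx)) (by simp [ENat.LEInfty.out])
  refine this.symm.trans ?_
  refine (congrArg _ (mlieBracket_const a b _)).trans ?_
  exact map_zero _

theorem IsSmoothOneForm.contMDiffAt_apply {η : Π x : M, TangentSpace 𝓘(ℝ, E) x →L[ℝ] ℝ}
    (hη : IsSmoothOneForm η) {X : Π x : M, TangentSpace 𝓘(ℝ, E) x} {x : M}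
    (hX : ContMDiffAt 𝓘(ℝ, E) 𝓘(ℝ, E).tangent ∞
      (fun y ↦ (⟨y, X y⟩ : TangentBundle 𝓘(ℝ, E) M)) x) :
    ContMDiffAt 𝓘(ℝ, E) 𝓘(ℝ) ∞ (fun y ↦ η y (X y)) x := by
  have : ContMDiffAt 𝓘(ℝ, E) (𝓘(ℝ, E).prod 𝓘(ℝ)) ∞
      (fun m ↦ Bundle.TotalSpace.mk' ℝ (E := Bundle.Trivial M ℝ) m (η m (X m))) x :=
    ContMDiffAt.clm_bundle_apply (F₁ := E) (hη x) hX
  simp only [Bundle.contMDiffAt_totalSpace] at this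
  exact this.2

/-- In the trivialization of the cotangent bundle, `df` is `mfderiv` read in tangent coordinates,
which is smooth. -/
theorem isSmoothOneForm_mvfderiv {f : M → ℝ} (hf : ContMDiff 𝓘(ℝ, E) 𝓘(ℝ) ∞ f) :
    IsSmoothOneForm (fun x ↦ mvfderiv 𝓘(ℝ, E) f x) := by
  intro x
  refine (contMDiffAt_hom_bundle _).2 ⟨contMDiffAt_id, ?_⟩
  convert! (hf x).mfderiv_const (m := ∞) (by simp) using 1
  ext y v
  simp [inTangentCoordinates, ContinuousLinearMap.inCoordinates]
  rfl

namespace LorentzMetric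

variable (g : LorentzMetric E M)

theorem isSmoothOneForm_val {Y : Π x : M, TangentSpace 𝓘(ℝ, E) x} (hY : IsSmoothVectorField Y) :
    IsSmoothOneForm (fun x ↦ g.val x (Y x)) :=
  ContMDiff.clm_bundle_apply (F₁ := E) (F₂ := E →L[ℝ] ℝ)
    (E₂ := fun x : M ↦ TangentSpace 𝓘(ℝ, E) x →L[ℝ] ℝ) g.contMDiff hY

theorem contMDiff_val_val {Y Z : Π x : M, TangentSpace 𝓘(ℝ, E) x} (hY : IsSmoothVectorField Y)
    (hZ : IsSmoothVectorField Z) : ContMDiff 𝓘(ℝ, E) 𝓘(ℝ) ∞ (fun x ↦ g.val x (Y x) (Z x)) :=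
  fun x ↦ (g.isSmoothOneForm_val hY).contMDiffAt_apply (hZ x)

end LorentzMetric

/-! ### One-forms in coordinates -/

variable [FiniteDimensional ℝ E]

/-- As `E` is finite-dimensional, it is enough that each component, the value of `η` on a coordinate
field, is smooth. -/
theorem IsSmoothOneForm.contDiffAt_chartForm {η : Π x : M, TangentSpace 𝓘(ℝ, E) x →L[ℝ] ℝ}
    (hη : IsSmoothOneForm η) {p x : M} (hx : x ∈ (extChartAt 𝓘(ℝ, E) p).source) :
    ContDiffAt ℝ ∞ (chartForm η p) (extChartAt 𝓘(ℝ, E) p x) := by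
  have := FiniteDimensional.complete ℝ E
  suffices h : ContDiffOn ℝ ∞ (chartForm η p) (extChartAt 𝓘(ℝ, E) p).target from
    h.contDiffAt ((isOpen_extChartAt_target p).mem_nhds ((extChartAt 𝓘(ℝ, E) p).map_source hx))
  refine contDiffOn_clm_apply.2 fun a e he ↦ ContDiffAt.contDiffWithinAt ?_
  have hy := (extChartAt 𝓘(ℝ, E) p).map_target he
  have := (hη.contMDiffAt_apply (contMDiffAt_coordField hy a)).contDiffAt_comp_extChartAt_symm hy
  rwa [(extChartAt 𝓘(ℝ, E) p).right_inv he] at this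

theorem IsSmoothOneForm.mvfderiv_apply_coordField
    {η : Π x : M, TangentSpace 𝓘(ℝ, E) x →L[ℝ] ℝ}
    (hη : IsSmoothOneForm η) {p x : M} (hx : x ∈ (extChartAt 𝓘(ℝ, E) p).source) (a b : E) :
    mvfderiv 𝓘(ℝ, E) (fun y ↦ η y (coordField p b y)) x (coordField p a x) =
      fderiv ℝ (chartForm η p) (extChartAt 𝓘(ℝ, E) p x) a b := by
  have := FiniteDimensional.complete ℝ E
  rw [mvfderiv_eq_fderiv_extChartAt hx (hη.contMDiffAt_apply (contMDiffAt_coordField hx b)),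
    chartDeriv_coordField hx]
  have h := (hη.contDiffAt_chartForm hx).differentiableAt (by simp)
  have := fderiv_clm_apply h (differentiableAt_const b)
  simp only [fderiv_fun_const, Pi.zero_apply, ContinuousLinearMap.comp_zero, zero_add] at this
  rw [← ContinuousLinearMap.flip_apply, ← this]
  rfl
-- Exterior derivative of a lowered vector field and the Poincaré lemma
namespace LorentzMetric

variable (g : LorentzMetric E M)

/-- This is `dY♭ = 2F` in coordinates. Metric compatibility expands `∂_a Y_b` as `∇_a Y_b + g(Y, ∇_a
∂_b)`; the last term is symmetric in `a, b` because the torsion and the bracket of coordinate fields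
both vanish. -/
theorem fderiv_chartForm_sub {Y : Π x : M, TangentSpace 𝓘(ℝ, E) x} (hY : IsSmoothVectorField Y)
    {p x : M} (hx : x ∈ (extChartAt 𝓘(ℝ, E) p).source) (a b : E) :
    fderiv ℝ (chartForm (fun x ↦ g.val x (Y x)) p) (extChartAt 𝓘(ℝ, E) p x) a b
        - fderiv ℝ (chartForm (fun x ↦ g.val x (Y x)) p) (extChartAt 𝓘(ℝ, E) p x) b a =
      2 * g.skewNabla Y x (coordField p a x) (coordField p b x) := by
  have := FiniteDimensional.complete ℝ E
  have hX (c : E) : MDiffAt (T% (coordField (M := M) p c)) x :=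
    (contMDiffAt_coordField hx c).mdifferentiableAt (by simp)
  have hYx : MDiffAt (T% Y) x := (hY x).mdifferentiableAt (by simp)
  have hη := g.isSmoothOneForm_val hY
  rw [← hη.mvfderiv_apply_coordField hx, ← hη.mvfderiv_apply_coordField hx,
    g.leviCivita_metric (hX a) hYx (hX b), g.leviCivita_metric (hX b) hYx (hX a)]
  have ht := g.leviCivita_torsion (hX a) (hX b)
  rw [mlieBracket_coordField hx, sub_eq_zero] at ht
  rw [ht, skewNabla, nabla, nabla]
  ring

theorem nabla_smul {Y : Π x : M, TangentSpace 𝓘(ℝ, E) x} {f : M → ℝ} {x : M}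
    (hY : MDiffAt (T% Y) x) (hf : MDiffAt f x) (u v : TangentSpace 𝓘(ℝ, E) x) :
    g.nabla (f • Y) x u v =
      f x * g.nabla Y x u v + mvfderiv 𝓘(ℝ, E) f x u * g.val x (Y x) v := by
  rw [nabla, g.leviCivita.isCovariantDerivativeOnUniv.leibniz hY hf]
  simp [nabla]

theorem mvfderiv_val_self {Y : Π x : M, TangentSpace 𝓘(ℝ, E) x} {x : M}
    (hY : MDiffAt (T% Y) x) (u : TangentSpace 𝓘(ℝ, E) x) :
    mvfderiv 𝓘(ℝ, E) (fun y ↦ g.val y (Y y) (Y y)) x u = 2 * g.nabla Y x u (Y x) := by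
  have := g.leviCivita_metric (FiberBundle.mdifferentiableAt_extend 𝓘(ℝ, E) E u) hY hY
  rw [FiberBundle.extend_apply_self] at this
  rw [this, g.symm x (Y x), nabla]
  ring

/-- Poincaré lemma: if `Y` with its index lowered is a closed one-form, then it is locally the
differential of a smooth function. -/
theorem exists_potential {Y : Π x : M, TangentSpace 𝓘(ℝ, E) x} (hY : IsSmoothVectorField Y)
    (hskew : ∀ (x : M) (u v : TangentSpace 𝓘(ℝ, E) x), g.skewNabla Y x u v = 0) (p : M) :
    ∃ U : Set M, IsOpen U ∧ p ∈ U ∧ ∃ f : M → ℝ, ContMDiffOn 𝓘(ℝ, E) 𝓘(ℝ, ℝ) ∞ f U ∧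
      ∀ x ∈ U, ∀ v : TangentSpace 𝓘(ℝ, E) x, g.val x (Y x) v = mvfderiv 𝓘(ℝ, E) f x v := by
  set c := extChartAt 𝓘(ℝ, E) p with hc
  set w := chartForm (fun x ↦ g.val x (Y x)) p with hw
  have hη := g.isSmoothOneForm_val hY
  have hsmooth (e : E) (he : e ∈ c.target) : ContDiffAt ℝ ∞ w e := by
    have := hη.contDiffAt_chartForm (c.map_target he)
    rwa [c.right_inv he] at this
  -- A ball inside the chart's target is convex, so a form with symmetric derivative has a primitive
  -- on it.
  obtain ⟨r, hr, hball⟩ := Metric.isOpen_iff.1 (isOpen_extChartAt_target (I := 𝓘(ℝ, E)) p) (c p)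
    (mem_extChartAt_target p)
  obtain ⟨F, hF⟩ := (convex_ball (c p) r).exists_forall_hasFDerivAt_of_fderiv_symmetric
    Metric.isOpen_ball
    (fun e he ↦ ((hsmooth e (hball he)).differentiableAt (by simp)).differentiableWithinAt)
    (fun e he a b ↦ by
      have := g.fderiv_chartForm_sub hY (c.map_target (hball he)) a b
      rw [hskew, mul_zero, sub_eq_zero, ← hc, c.right_inv (hball he)] at this
      exact this)
  -- The derivative of `F` is the smooth form `w`, so `F` is itself smooth.
  have hFsmooth : ContDiffOn ℝ ∞ F (Metric.ball (c p) r) := by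
    rw [contDiffOn_infty_iff_fderiv_of_isOpen Metric.isOpen_ball]
    exact ⟨fun e he ↦ (hF e he).differentiableAt.differentiableWithinAt,
      ContDiffOn.congr (fun e he ↦ (hsmooth e (hball he)).contDiffWithinAt)
        fun e he ↦ (hF e he).fderiv⟩
  refine ⟨c.source ∩ c ⁻¹' Metric.ball (c p) r,
    (continuousOn_extChartAt p).isOpen_inter_preimage (isOpen_extChartAt_source p)
      Metric.isOpen_ball, ⟨mem_extChartAt_source p, Metric.mem_ball_self hr⟩, F ∘ c, ?_, ?_⟩
  · exact hFsmooth.contMDiffOn.comp ((contMDiffOn_extChartAt (I := 𝓘(ℝ, E)) (n := ∞) (x := p)).mono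
      fun x hx ↦ by simpa [hc] using hx.1) fun x hx ↦ hx.2
  · rintro x ⟨hx, hxr⟩ v
    rw [mvfderiv_comp_extChartAt hx (hF _ hxr).differentiableAt, (hF _ hxr).fderiv, hw,
      chartForm_apply]
    rw [← hc, c.left_inv hx]
    exact congrArg (g.val x (Y x)) (coordField_chartDeriv hx v).symm

/-- The exterior derivative of `lam df` is `dlam ∧ df`. -/
theorem two_mul_skewNabla_of_eq_mul_mvfderiv {Y : Π x : M, TangentSpace 𝓘(ℝ, E) x}
    (hY : IsSmoothVectorField Y) {U : Set M} (hU : IsOpen U) {f lam : M → ℝ}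
    (hf : ContMDiffOn 𝓘(ℝ, E) 𝓘(ℝ, ℝ) ∞ f U) (hlam : ContMDiffOn 𝓘(ℝ, E) 𝓘(ℝ, ℝ) ∞ lam U)
    (h : ∀ x ∈ U, ∀ v : TangentSpace 𝓘(ℝ, E) x,
      g.val x (Y x) v = lam x * mvfderiv 𝓘(ℝ, E) f x v)
    {x : M} (hx : x ∈ U) (u v : TangentSpace 𝓘(ℝ, E) x) :
    2 * g.skewNabla Y x u v =
      mvfderiv 𝓘(ℝ, E) lam x u * mvfderiv 𝓘(ℝ, E) f x v
        - mvfderiv 𝓘(ℝ, E) lam x v * mvfderiv 𝓘(ℝ, E) f x u := by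
  set c := extChartAt 𝓘(ℝ, E) x with hc
  have hxc : x ∈ c.source := mem_extChartAt_source x
  have hf' (y : M) (hy : y ∈ U) := hf.contMDiffAt (hU.mem_nhds hy)
  have hlam' := hlam.contMDiffAt (hU.mem_nhds hx)
  have hφ := (hf' x hx).contDiffAt_comp_extChartAt_symm hxc
  have hl := hlam'.contDiffAt_comp_extChartAt_symm hxc
  rw [← hc] at hφ hl
  have hev : chartForm (fun x ↦ g.val x (Y x)) x =ᶠ[𝓝 (c x)]
      fun e ↦ (lam ∘ c.symm) e • fderiv ℝ (f ∘ c.symm) e := by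
    have hcont : ContinuousAt c.symm (c x) := continuousAt_extChartAt_symm x
    filter_upwards [extChartAt_target_mem_nhds (I := 𝓘(ℝ, E)) x,
      hcont.preimage_mem_nhds (hU.mem_nhds (by rwa [c.left_inv hxc]))] with e he heU
    ext a
    rw [chartForm_apply, ← hc, h _ heU,
      mvfderiv_eq_fderiv_extChartAt (c.map_target he) (hf' _ heU),
      chartDeriv_coordField (c.map_target he), ← hc, c.right_inv he]
    rfl
  have hd : DifferentiableAt ℝ (fderiv ℝ (f ∘ c.symm)) (c x) :=
    (hφ.fderiv_right (m := 1) (by norm_num [ENat.LEInfty.out])).differentiableAt (by simp)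
  -- Symmetry of the second derivative removes the term `λ d(df)` of the product rule.
  have hsymm : IsSymmSndFDerivAt ℝ (f ∘ c.symm) (c x) :=
    hφ.isSymmSndFDerivAt (by simp [ENat.LEInfty.out])
  have key := g.fderiv_chartForm_sub hY hxc
    (chartDeriv x x u) (chartDeriv x x v)
  rw [coordField_chartDeriv hxc, coordField_chartDeriv hxc] at key
  rw [← key, mvfderiv_eq_fderiv_extChartAt hxc (hf' x hx),
    mvfderiv_eq_fderiv_extChartAt hxc (hf' x hx), mvfderiv_eq_fderiv_extChartAt hxc hlam',
    mvfderiv_eq_fderiv_extChartAt hxc hlam', ← hc, hev.fderiv_eq,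
    fderiv_fun_smul (hl.differentiableAt (by simp)) hd]
  simp only [add_apply, smul_apply, ContinuousLinearMap.smulRight_apply, smul_eq_mul]
  rw [hsymm.eq (chartDeriv x x u) (chartDeriv x x v)]
  ring

/-! ### Conformal Killing fields and hypersurface orthogonality -/

variable {g} {ξ : Π x : M, TangentSpace 𝓘(ℝ, E) x} {κ : M → ℝ}

theorem IsConformalKilling.nabla_eq (h : g.IsConformalKilling ξ κ) (x : M)
    (u v : TangentSpace 𝓘(ℝ, E) x) :
    g.nabla ξ x u v = κ x * g.val x u v + g.skewNabla ξ x u v := by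
  rw [skewNabla]
  linear_combination (1 / 2 : ℝ) * h x u v

theorem isConformalKilling_of_nabla_eq {α : Π x : M, TangentSpace 𝓘(ℝ, E) x →L[ℝ] ℝ}
    (h : ∀ (x : M) (u v : TangentSpace 𝓘(ℝ, E) x), g.nabla ξ x u v = κ x * g.val x u v
      + α x u * g.val x (ξ x) v - g.val x (ξ x) u * α x v) :
    g.IsConformalKilling ξ κ := by
  intro x u v
  rw [h, h, g.symm x v u]
  ring

/-- The covector field `ξ_i / g(ξ, ξ)` is closed, so `ξ` is hypersurface orthogonal. -/
theorem isHypersurfaceOrthogonal_of_nabla_eq (hξ : IsSmoothVectorField ξ)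
    (hξ_timelike : g.IsTimelike ξ) {α : Π x : M, TangentSpace 𝓘(ℝ, E) x →L[ℝ] ℝ}
    (hα : ∀ x, α x (ξ x) = 0)
    (h : ∀ (x : M) (u v : TangentSpace 𝓘(ℝ, E) x), g.nabla ξ x u v = κ x * g.val x u v
      + α x u * g.val x (ξ x) v - g.val x (ξ x) u * α x v) :
    g.IsHypersurfaceOrthogonal ξ := by
  intro p
  set N : M → ℝ := fun x ↦ g.val x (ξ x) (ξ x) with hN
  have hN0 (x : M) : N x ≠ 0 := (hξ_timelike x).ne
  have hNs : ContMDiff 𝓘(ℝ, E) 𝓘(ℝ) ∞ N := g.contMDiff_val_val hξ hξ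
  have hNinv : ContMDiff 𝓘(ℝ, E) 𝓘(ℝ) ∞ (fun x ↦ (N x)⁻¹) := hNs.inv₀ hN0
  have hY : IsSmoothVectorField ((fun x ↦ (N x)⁻¹) • ξ) := hNinv.smul_section hξ
  have hskew (x : M) (u v : TangentSpace 𝓘(ℝ, E) x) :
      g.skewNabla ((fun x ↦ (N x)⁻¹) • ξ) x u v = 0 := by
    have hξx : MDiffAt (T% ξ) x := (hξ x).mdifferentiableAt (by simp)
    have hNx : MDiffAt N x := (hNs x).mdifferentiableAt (by simp)
    have hix : MDiffAt (fun x ↦ (N x)⁻¹) x := (hNinv x).mdifferentiableAt (by simp)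
    have hd (w : TangentSpace 𝓘(ℝ, E) x) : mvfderiv 𝓘(ℝ, E) (fun x ↦ (N x)⁻¹) x w =
        -((N x)⁻¹ * (N x)⁻¹) * (2 * (κ x * g.val x (ξ x) w + α x w * N x)) := by
      -- The derivative of `N⁻¹` comes from differentiating `N * N⁻¹ = 1`.
      have h1 := mvfderiv_fun_mul hNx hix
      have h2 : (fun y ↦ N y * (N y)⁻¹) = fun _ ↦ (1 : ℝ) := by
        ext y; exact mul_inv_cancel₀ (hN0 y)
      rw [h2, mvfderiv_const] at h1
      have h3 := congrArg (fun φ : TangentSpace 𝓘(ℝ, E) x →L[ℝ] ℝ ↦ φ w) h1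
      have h4 : mvfderiv 𝓘(ℝ, E) N x w = 2 * (κ x * g.val x (ξ x) w + α x w * N x) := by
        rw [hN, g.mvfderiv_val_self hξx, h, hα, g.symm x w]
        ring
      simp only [zero_apply, add_apply, smul_apply, smul_eq_mul, h4] at h3
      have := hN0 x
      field_simp at h3 ⊢
      linear_combination -h3
    rw [skewNabla, g.nabla_smul hξx hix, g.nabla_smul hξx hix, hd, hd, h, h, g.symm x v u]
    have := hN0 x
    field_simp
    ring
  obtain ⟨U, hU, hpU, f, hf, hfξ⟩ := g.exists_potential hY hskew p
  have hfξ' (x : M) (hx : x ∈ U) (v : TangentSpace 𝓘(ℝ, E) x) :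
      g.val x (ξ x) v = N x * mvfderiv 𝓘(ℝ, E) f x v := by
    rw [← hfξ x hx]
    simp [hN0 x]
  refine ⟨U, hU, hpU, f, N, hf, hNs.contMDiffOn, fun x hx h0 ↦ ?_, hfξ'⟩
  -- If `df` vanished at `x`, evaluating `ξ♭ = N df` on `ξ` would give `N x = 0`.
  have := hfξ' x hx (ξ x)
  rw [h0] at this
  exact hN0 x (by simpa using this)

/-- The form is forced: inserting `ξ` in the second slot of the required identity gives `F(·, ξ) = N
α`. It involves no local choice of `f` and `lam`, so no gluing is needed. -/
theorem IsHypersurfaceOrthogonal.exists_skewNabla_eq (hHO : g.IsHypersurfaceOrthogonal ξ)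
    (hξ : IsSmoothVectorField ξ) (hξ_timelike : g.IsTimelike ξ)
    (hκ : ContMDiff 𝓘(ℝ, E) 𝓘(ℝ, ℝ) ∞ κ) (hCK : g.IsConformalKilling ξ κ) :
    ∃ α : Π x : M, TangentSpace 𝓘(ℝ, E) x →L[ℝ] ℝ,
      IsSmoothOneForm α ∧ (∀ x, α x (ξ x) = 0) ∧
      ∀ (x : M) (u v : TangentSpace 𝓘(ℝ, E) x),
        g.skewNabla ξ x u v = α x u * g.val x (ξ x) v - g.val x (ξ x) u * α x v := by
  set N : M → ℝ := fun x ↦ g.val x (ξ x) (ξ x) with hN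
  have hN0 (x : M) : N x ≠ 0 := (hξ_timelike x).ne
  have hNs : ContMDiff 𝓘(ℝ, E) 𝓘(ℝ) ∞ N := g.contMDiff_val_val hξ hξ
  -- This equals `F(·, ξ) / N`, since `½ dN = ∇ξ♭(·, ξ) = κ ξ♭ + F(·, ξ)`; in this form its
  -- smoothness is visible.
  let α : Π x : M, TangentSpace 𝓘(ℝ, E) x →L[ℝ] ℝ := fun x ↦
    (N x)⁻¹ • ((1 / 2 : ℝ) • mvfderiv 𝓘(ℝ, E) N x - κ x • g.val x (ξ x))
  have hα (x : M) (u : TangentSpace 𝓘(ℝ, E) x) : α x u = (N x)⁻¹ * g.skewNabla ξ x u (ξ x) := by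
    have hξx : MDiffAt (T% ξ) x := (hξ x).mdifferentiableAt (by simp)
    have := hCK.nabla_eq x u (ξ x)
    have h2 := g.mvfderiv_val_self hξx u
    simp only [α, smul_apply, sub_apply, smul_eq_mul]
    rw [hN, h2, this, g.symm x u]
    ring
  refine ⟨α, ?_, fun x ↦ ?_, fun x u v ↦ ?_⟩
  · exact (hNs.inv₀ hN0).smul_section
      ((contMDiff_const.smul_section (isSmoothOneForm_mvfderiv hNs)).sub_section
        (hκ.smul_section (g.isSmoothOneForm_val hξ)))
  · rw [hα]
    simp [skewNabla]
  · obtain ⟨U, hU, hxU, f, lam, hf, hlam, -, hfξ⟩ := hHO x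
    have key (a b : TangentSpace 𝓘(ℝ, E) x) :=
      g.two_mul_skewNabla_of_eq_mul_mvfderiv hξ hU hf hlam hfξ hxU a b
    have hNx : N x = lam x * mvfderiv 𝓘(ℝ, E) f x (ξ x) := hfξ x hxU (ξ x)
    have hl0 : lam x ≠ 0 := fun h0 ↦ hN0 x (by rw [hNx, h0, zero_mul])
    rw [hα, hα, hfξ x hxU, hfξ x hxU]
    have h0 := hN0 x
    rw [inv_mul_eq_div, inv_mul_eq_div]
    field_simp
    rw [hNx]
    -- The combination in parentheses is `2F ∧ df = dλ ∧ df ∧ df = 0` evaluated on `(u, v, ξ)`.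
    linear_combination (lam x / 2) * (mvfderiv 𝓘(ℝ, E) f x (ξ x) * key u v
      - mvfderiv 𝓘(ℝ, E) f x v * key u (ξ x) + mvfderiv 𝓘(ℝ, E) f x u * key v (ξ x))

end LorentzMetric

end

/-! ### The main theorem -/

theorem mainTheorem6
    {E : Type*} [NormedAddCommGroup E] [NormedSpace ℝ E] [FiniteDimensional ℝ E]
    {M : Type*} [TopologicalSpace M] [ChartedSpace E M] [IsManifold 𝓘(ℝ, E) ∞ M]
    (g : LorentzMetric E M) (ξ : Π x : M, TangentSpace 𝓘(ℝ, E) x)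
    (hξ : IsSmoothVectorField ξ) (hξ_timelike : g.IsTimelike ξ) :
    -- a conformal Killing `ξ` is hypersurface orthogonal iff `F_ij = α_i ξ_j - ξ_i α_j`, `α·ξ = 0`,
    -- i.e. iff `∇_i ξ_j = κ g_ij + α_i ξ_j - ξ_i α_j`, `α·ξ = 0`
    (∀ κ : M → ℝ, ContMDiff 𝓘(ℝ, E) 𝓘(ℝ, ℝ) ∞ κ → g.IsConformalKilling ξ κ →
      (g.IsHypersurfaceOrthogonal ξ ↔
        ∃ α : Π x : M, TangentSpace 𝓘(ℝ, E) x →L[ℝ] ℝ,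
          IsSmoothOneForm α ∧ (∀ x, α x (ξ x) = 0) ∧
          ∀ (x : M) (u v : TangentSpace 𝓘(ℝ, E) x),
            g.skewNabla ξ x u v = α x u * g.val x (ξ x) v - g.val x (ξ x) u * α x v) ∧
      (g.IsHypersurfaceOrthogonal ξ ↔
        ∃ α : Π x : M, TangentSpace 𝓘(ℝ, E) x →L[ℝ] ℝ,
          IsSmoothOneForm α ∧ (∀ x, α x (ξ x) = 0) ∧
          ∀ (x : M) (u v : TangentSpace 𝓘(ℝ, E) x),
            g.nabla ξ x u v = κ x * g.val x u v
              + α x u * g.val x (ξ x) v - g.val x (ξ x) u * α x v)) ∧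
    -- doubly torqued with `α = -β` means hypersurface orthogonal and conformal Killing
    (∀ κ : M → ℝ, ContMDiff 𝓘(ℝ, E) 𝓘(ℝ, ℝ) ∞ κ →
      ((∃ α β : Π x : M, TangentSpace 𝓘(ℝ, E) x →L[ℝ] ℝ,
          IsSmoothOneForm α ∧ IsSmoothOneForm β ∧ α = -β ∧ g.IsDoublyTorqued ξ κ α β) ↔
        g.IsConformalKilling ξ κ ∧ g.IsHypersurfaceOrthogonal ξ)) ∧
    -- and, if moreover `κ = 0`, hypersurface orthogonal and Killing
    ((∃ α β : Π x : M, TangentSpace 𝓘(ℝ, E) x →L[ℝ] ℝ,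
        IsSmoothOneForm α ∧ IsSmoothOneForm β ∧ α = -β ∧
          g.IsDoublyTorqued ξ (fun _ ↦ 0) α β) ↔
      g.IsKilling ξ ∧ g.IsHypersurfaceOrthogonal ξ) := by
  have forms (κ : M → ℝ) (hCK : g.IsConformalKilling ξ κ)
      (α : Π x : M, TangentSpace 𝓘(ℝ, E) x →L[ℝ] ℝ) :
      (∀ (x : M) (u v : TangentSpace 𝓘(ℝ, E) x),
        g.skewNabla ξ x u v = α x u * g.val x (ξ x) v - g.val x (ξ x) u * α x v) ↔
      ∀ (x : M) (u v : TangentSpace 𝓘(ℝ, E) x), g.nabla ξ x u v = κ x * g.val x u v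
        + α x u * g.val x (ξ x) v - g.val x (ξ x) u * α x v := by
    refine forall_congr' fun x ↦ forall_congr' fun u ↦ forall_congr' fun v ↦ ?_
    -- For a conformal Killing field the two displayed equations differ only by `κ g` on both sides.
    rw [hCK.nabla_eq, add_sub_assoc, add_right_inj]
  have part1 (κ : M → ℝ) (hκ : ContMDiff 𝓘(ℝ, E) 𝓘(ℝ, ℝ) ∞ κ) (hCK : g.IsConformalKilling ξ κ) :
      g.IsHypersurfaceOrthogonal ξ ↔ ∃ α : Π x : M, TangentSpace 𝓘(ℝ, E) x →L[ℝ] ℝ,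
        IsSmoothOneForm α ∧ (∀ x, α x (ξ x) = 0) ∧
        ∀ (x : M) (u v : TangentSpace 𝓘(ℝ, E) x), g.nabla ξ x u v = κ x * g.val x u v
          + α x u * g.val x (ξ x) v - g.val x (ξ x) u * α x v := by
    constructor
    · intro hHO
      obtain ⟨α, hα, hαξ, h⟩ := hHO.exists_skewNabla_eq hξ hξ_timelike hκ hCK
      exact ⟨α, hα, hαξ, (forms κ hCK α).1 h⟩
    · rintro ⟨α, -, hαξ, h⟩
      exact LorentzMetric.isHypersurfaceOrthogonal_of_nabla_eq hξ hξ_timelike hαξ h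
  have part2 (κ : M → ℝ) (hκ : ContMDiff 𝓘(ℝ, E) 𝓘(ℝ, ℝ) ∞ κ) :
      (∃ α β : Π x : M, TangentSpace 𝓘(ℝ, E) x →L[ℝ] ℝ,
          IsSmoothOneForm α ∧ IsSmoothOneForm β ∧ α = -β ∧ g.IsDoublyTorqued ξ κ α β) ↔
        g.IsConformalKilling ξ κ ∧ g.IsHypersurfaceOrthogonal ξ := by
    constructor
    · rintro ⟨α, β, -, -, hαβ, h⟩
      have hβ (x : M) (v : TangentSpace 𝓘(ℝ, E) x) : β x v = -α x v := by
        rw [hαβ]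
        exact (neg_neg _).symm
      have h' (x : M) (u v : TangentSpace 𝓘(ℝ, E) x) : g.nabla ξ x u v = κ x * g.val x u v
          + α x u * g.val x (ξ x) v - g.val x (ξ x) u * α x v := by
        rw [h.nabla_eq, hβ]
        ring
      exact ⟨LorentzMetric.isConformalKilling_of_nabla_eq h',
        LorentzMetric.isHypersurfaceOrthogonal_of_nabla_eq hξ hξ_timelike h.left_orthogonal h'⟩
    · rintro ⟨hCK, hHO⟩
      obtain ⟨α, hα, hαξ, h⟩ := (part1 κ hκ hCK).1 hHO
      refine ⟨α, -α, hα, hα.neg_section, (neg_neg α).symm, ⟨fun x u v ↦ ?_, hαξ, fun x ↦ ?_⟩⟩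
      · rw [h, sub_eq_add_neg, ← mul_neg]
        rfl
      · exact neg_eq_zero.2 (hαξ x)
  refine ⟨fun κ hκ hCK ↦ ⟨?_, part1 κ hκ hCK⟩, part2, ?_⟩
  · rw [part1 κ hκ hCK]
    exact exists_congr fun α ↦ and_congr_right fun _ ↦ and_congr_right fun _ ↦
      (forms κ hCK α).symm
  · rw [part2 _ contMDiff_const]
    refine and_congr_left fun _ ↦ ?_
    simp [LorentzMetric.IsConformalKilling, LorentzMetric.IsKilling]
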